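/- A profinite group $G$ is \emph{just infinite} if it is infinite and every non-trivial closed normal subgroup of $G$ is open; it is \emph{hereditarily just infinite} if it is just infinite and every open subgroup of $G$ is just infinite. Given a descending chain $\mathcal{G}=(G_n)$ of open normal subgroups of $G$ with trivial intersection, the Hausdorff dimension of a closed subgroup $H$ is $\dim_{\mathrm{H},\mathcal{G}}(H)=\liminf_{n\to\infty}\frac{\log|HG_n:G_n|}{\log|G:G_n|}$, and $G$ has \emph{complete Hausdorff dimension spectrum} with respect to $\mathcal{G}$ if $\{\dim_{\mathrm{H},\mathcal{G}}(H) : H\le_c G\}=[0,1]$. For permutation groups $A\le\mathrm{Sym}(\Omega)$ and $B\le\mathrm{Sym}(\Lambda)$ on finite sets, let $A\wr B=A^{\Lambda}\rtimes B$ act on $\Omega^{\Lambda}$ by the product action. For a sequence $\mathcal{S}=(S_k\le\mathrm{Sym}(\Omega_k))_{k\in\mathbb{N}}$ of finite permutation groups on finite sets, let $W_0=S_0$, acting on $\Omega_0$, let $W_{n+1}=S_{n+1}\wr W_n$ with its product action, let $W^{\mathrm{pa}}(\mathcal{S})=\varprojlim W_n$ along the natural projections $W_{n+1}\to W_n$,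 and let $N_n=\ker(W^{\mathrm{pa}}(\mathcal{S})\to W_n)$. Call $\mathcal{S}$ \emph{good} if there are a real $A>0$ and $M_0\in\mathbb{N}$ with $|S_k|\le|S_{k+1}|^{A}$ for all $k\ge M_0$. \textbf{Corollary B.} There exist hereditarily just infinite profinite groups $G$ with complete Hausdorff dimension spectrum with respect to some filtration by open normal subgroups. More precisely: (a) if $\mathcal{S}$ is a good sequence of finite transitive non-abelian simple permutation groups, then $W^{\mathrm{pa}}(\mathcal{S})$ is hereditarily just infinite and has complete Hausdorff dimension spectrum with respect to $(N_n)_n$; (b) every constant sequence $S_k=T\le\mathrm{Sym}(\Omega)$, with $\Omega$ finite and $T$ transitive, non-abelian and simple, is good; (c) such permutation groups $T$ exist; for some such $T$ on a finite set, the group $W^{\mathrm{pa}}(T,T,T,\dots)$ is hereditarily just infinite with complete Hausdorff dimension spectrum with respect to $(N_n)_n$. -/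

import Mathlib

universe u

section HausdorffDimension

/-- A filtration of a topological group by open normal subgroups: a descending chain
`G₀ ≥ G₁ ≥ …` of open normal subgroups with trivial intersection. -/
structure NormalFiltration (G : Type*) [Group G] [TopologicalSpace G] where
  term : ℕ → Subgroup G
  antitone_term : Antitone term
  normal_term : ∀ n, (term n).Normal
  isOpen_term : ∀ n, IsOpen (term n : Set G)
  iInf_term : ⨅ n, term n = ⊥

/-- The Hausdorff dimension `liminf log |H Gₙ : Gₙ| / log |G : Gₙ|` of a subgroup `H`
with respect to the filtration `(Gₙ)`. -/
noncomputable def hausdorffDim {G : Type*} [Group G] [TopologicalSpace G]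
    (F : NormalFiltration G) (H : Subgroup G) : ℝ :=
  Filter.liminf
    (fun n : ℕ =>
      Real.log ((F.term n).relIndex (H ⊔ F.term n)) / Real.log ((F.term n).index))
    Filter.atTop

/-- The Hausdorff dimension spectrum: the set of dimensions of closed subgroups. -/
def hausdorffSpectrum {G : Type*} [Group G] [TopologicalSpace G]
    (F : NormalFiltration G) : Set ℝ :=
  {d | ∃ H : Subgroup G, IsClosed (H : Set G) ∧ hausdorffDim F H = d}

/-- The spectrum is complete when it is the whole interval `[0, 1]`. -/
def HasCompleteSpectrum {G : Type*} [Group G] [TopologicalSpace G]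
    (F : NormalFiltration G) : Prop :=
  hausdorffSpectrum F = Set.Icc (0 : ℝ) 1

end HausdorffDimension

section JustInfinite

/-- A (profinite) group is just infinite if it is infinite and every non-trivial closed normal
subgroup is open. -/
def IsJustInfinite (G : Type*) [Group G] [TopologicalSpace G] : Prop :=
  Infinite G ∧
    ∀ N : Subgroup G, N.Normal → IsClosed (N : Set G) → N ≠ ⊥ → IsOpen (N : Set G)

/-- A just infinite (profinite) group is hereditarily just infinite if every open subgroup is
just infinite. -/
def IsHereditarilyJustInfinite (G : Type*) [Group G] [TopologicalSpace G] : Prop :=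
  IsJustInfinite G ∧ ∀ H : Subgroup G, IsOpen (H : Set G) → IsJustInfinite H

end JustInfinite

section WreathProduct

/-- A group together with an action on a set, given as a homomorphism to the symmetric group. -/
structure ActingGroup where
  pt : Type u
  grp : Type u
  group : Group grp
  act : grp →* Equiv.Perm pt

attribute [instance] ActingGroup.group

/-- A permutation group `A ≤ Sym(Ω)`, acting on `Ω`. -/
def permGroup {Ω : Type u} (A : Subgroup (Equiv.Perm Ω)) : ActingGroup.{u} where
  pt := Ω
  grp := A
  group := inferInstance
  act := A.subtype

/-- The action of `B` on the base group `A^Λ` by permutation of the coordinates, for `B` acting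
on `Λ`. -/
def permuteCoords {Ω : Type u} (A : Subgroup (Equiv.Perm Ω)) (B : ActingGroup.{u}) :
    B.grp →* MulAut (B.pt → A) where
  toFun b :=
    { toFun := fun a l => a ((B.act b)⁻¹ l)
      invFun := fun a l => a (B.act b l)
      left_inv := fun a => by funext l; simp
      right_inv := fun a => by funext l; simp
      map_mul' := fun _ _ => rfl }
  map_one' := by ext a l; simp
  map_mul' b c := by ext a l; simp [mul_inv_rev]

/-- The wreath product `A ≀ B = A^Λ ⋊ B` of a permutation group `A ≤ Sym(Ω)` by a group `B`
acting on `Λ`, with the product action on `Ω^Λ`: the pair `(a, b)` sends `f : Λ → Ω` to the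
function `l ↦ a(l) · f(b⁻¹ · l)`. -/
def productWreath {Ω : Type u} (A : Subgroup (Equiv.Perm Ω)) (B : ActingGroup.{u}) :
    ActingGroup.{u} where
  pt := B.pt → Ω
  grp := (B.pt → A) ⋊[permuteCoords A B] B.grp
  group := inferInstance
  act :=
    { toFun := fun g =>
        { toFun := fun f l => (g.left l : Equiv.Perm Ω) (f ((B.act g.right)⁻¹ l))
          invFun := fun f l =>
            ((g.left (B.act g.right l) : Equiv.Perm Ω))⁻¹ (f (B.act g.right l))
          left_inv := fun f => by funext l; simp
          right_inv := fun f => by funext l; simp }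
      map_one' := by ext f l; simp
      map_mul' := fun g h => by
        ext f l
        change (((g.left * permuteCoords A B g.right h.left) l : A) : Equiv.Perm Ω)
          (f ((B.act (g.right * h.right))⁻¹ l)) = _
        simp [permuteCoords] }

/-- If `Ω` has at least two points and `B` is a permutation group, then so is `A ≀ B`: the
product action embeds `A ≀ B` in `Sym(Ω^Λ)`. -/
theorem productWreath_act_injective {Ω : Type u} [Nontrivial Ω] (A : Subgroup (Equiv.Perm Ω))
    (B : ActingGroup.{u}) (hB : Function.Injective B.act) :
    Function.Injective (productWreath A B).act := by
  classical
  rw [injective_iff_map_eq_one]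
  intro g hg
  have key : ∀ (f : B.pt → Ω) (l : B.pt),
      (g.left l : Equiv.Perm Ω) (f ((B.act g.right)⁻¹ l)) = f l := fun f l =>
    congrFun (DFunLike.congr_fun hg f) l
  have hleft : ∀ l, g.left l = 1 := fun l => by
    ext x
    exact key (fun _ => x) l
  have hact : (B.act g.right)⁻¹ = 1 := by
    ext l
    by_contra hne
    obtain ⟨x, y, hxy⟩ := exists_pair_ne Ω
    have h := key (fun m => if m = l then x else y) l
    rw [hleft l] at h
    have hne' : ¬ ((B.act g.right)⁻¹ l = l) := hne
    simp only [hne', if_false, if_true] at h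
    exact hxy h.symm
  have hright : g.right = 1 := hB (by rw [map_one]; exact inv_eq_one.mp hact)
  exact SemidirectProduct.ext (funext hleft) hright

end WreathProduct

section IteratedWreathProduct

variable {Ω : ℕ → Type u}

/-- The iterated wreath products with respect to product actions, with the indices starting
at `0`: the group `W₀ = S₀` acts on `Ω₀`, and the group `Wₙ₊₁ = Sₙ₊₁ ≀ Wₙ` acts on the set of
functions from the set on which `Wₙ` acts to `Ωₙ₊₁`. -/
def iteratedStage (S : ∀ k, Subgroup (Equiv.Perm (Ω k))) : ℕ → ActingGroup.{u}
  | 0 => permGroup (S 0)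
  | n + 1 => productWreath (S (n + 1)) (iteratedStage S n)

/-- The iterated wreath products are permutation groups when every `Ωₖ` has two points. -/
theorem iteratedStage_act_injective [∀ k, Nontrivial (Ω k)]
    (S : ∀ k, Subgroup (Equiv.Perm (Ω k))) (n : ℕ) :
    Function.Injective (iteratedStage S n).act := by
  induction n with
  | zero => exact Subtype.val_injective
  | succ n ih => exact productWreath_act_injective _ _ ih

/-- The group `Wₙ`. -/
def IteratedWreath (S : ∀ k, Subgroup (Equiv.Perm (Ω k))) (n : ℕ) : Type u :=
  (iteratedStage S n).grp

instance (S : ∀ k, Subgroup (Equiv.Perm (Ω k))) (n : ℕ) : Group (IteratedWreath S n) :=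
  (iteratedStage S n).group

instance (S : ∀ k, Subgroup (Equiv.Perm (Ω k))) (n : ℕ) :
    TopologicalSpace (IteratedWreath S n) := ⊥

instance (S : ∀ k, Subgroup (Equiv.Perm (Ω k))) (n : ℕ) :
    DiscreteTopology (IteratedWreath S n) := ⟨rfl⟩

/-- The natural projection `Wₙ₊₁ = Sₙ₊₁ ≀ Wₙ → Wₙ`. -/
def wreathProj (S : ∀ k, Subgroup (Equiv.Perm (Ω k))) (n : ℕ) :
    IteratedWreath S (n + 1) →* IteratedWreath S n :=
  SemidirectProduct.rightHom (φ := permuteCoords (S (n + 1)) (iteratedStage S n))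

theorem iteratedStage_finite [∀ k, Finite (Ω k)] (S : ∀ k, Subgroup (Equiv.Perm (Ω k))) (n : ℕ) :
    Finite (iteratedStage S n).pt ∧ Finite (iteratedStage S n).grp := by
  induction n with
  | zero =>
    exact ⟨inferInstanceAs (Finite (Ω 0)), inferInstanceAs (Finite (S 0))⟩
  | succ n ih =>
    obtain ⟨h₁, h₂⟩ := ih
    refine ⟨inferInstanceAs (Finite ((iteratedStage S n).pt → Ω (n + 1))), ?_⟩
    exact Finite.of_equiv (((iteratedStage S n).pt → S (n + 1)) × (iteratedStage S n).grp)
      SemidirectProduct.equivProd.symm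

instance [∀ k, Finite (Ω k)] (S : ∀ k, Subgroup (Equiv.Perm (Ω k))) (n : ℕ) :
    Finite (IteratedWreath S n) :=
  (iteratedStage_finite S n).2

/-- The inverse limit of `W₀ ← W₁ ← W₂ ← …`, as a subgroup of the direct product of the `Wₙ`
with the product topology, every `Wₙ` being discrete. -/
def wreathLimit (S : ∀ k, Subgroup (Equiv.Perm (Ω k))) :
    Subgroup (∀ n, IteratedWreath S n) where
  carrier := {g | ∀ n, wreathProj S n (g (n + 1)) = g n}
  mul_mem' := fun {g h} hg hh n => by
    rw [Pi.mul_apply, map_mul, hg n, hh n, Pi.mul_apply]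
  one_mem' := fun n => by simp
  inv_mem' := fun {g} hg n => by
    rw [Pi.inv_apply, map_inv, hg n, Pi.inv_apply]

theorem isClosed_wreathLimit (S : ∀ k, Subgroup (Equiv.Perm (Ω k))) :
    IsClosed (wreathLimit S : Set (∀ n, IteratedWreath S n)) := by
  have h : (wreathLimit S : Set (∀ n, IteratedWreath S n)) =
      ⋂ n, {g | wreathProj S n (g (n + 1)) = g n} := by
    ext g
    simp [wreathLimit]
  rw [h]
  refine isClosed_iInter fun n => isClosed_eq ?_ (continuous_apply n)
  exact continuous_of_discreteTopology.comp (continuous_apply (n + 1))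

instance [∀ k, Finite (Ω k)] (S : ∀ k, Subgroup (Equiv.Perm (Ω k))) :
    CompactSpace (wreathLimit S) :=
  isCompact_iff_compactSpace.mp (isClosed_wreathLimit S).isCompact

/-- The infinitely iterated wreath product `W^pa(S)` of type `S` with respect to product actions,
a profinite group. -/
def infiniteWreath [∀ k, Finite (Ω k)] (S : ∀ k, Subgroup (Equiv.Perm (Ω k))) :
    ProfiniteGrp.{u} :=
  ProfiniteGrp.of (wreathLimit S)

/-- The natural homomorphism `W^pa(S) → Wₙ`. -/
def toIteratedWreath [∀ k, Finite (Ω k)] (S : ∀ k, Subgroup (Equiv.Perm (Ω k))) (n : ℕ) :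
    infiniteWreath S →* IteratedWreath S n :=
  (Pi.evalMonoidHom (fun n => IteratedWreath S n) n).comp (wreathLimit S).subtype

/-- The filtration of `W^pa(S)` by the kernels `Nₙ` of the natural homomorphisms to `Wₙ`. -/
def levelFiltration [∀ k, Finite (Ω k)] (S : ∀ k, Subgroup (Equiv.Perm (Ω k))) :
    NormalFiltration (infiniteWreath S) where
  term n := (toIteratedWreath S n).ker
  antitone_term := antitone_nat_of_succ_le fun n g hg => by
    have hg' : (g : wreathLimit S).1 (n + 1) = 1 := hg
    have h := (g : wreathLimit S).2 n
    rw [hg', map_one] at h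
    exact h.symm
  normal_term n := inferInstance
  isOpen_term n := by
    have hc : Continuous (toIteratedWreath S n) :=
      (continuous_apply n).comp continuous_subtype_val
    exact (isOpen_discrete ({1} : Set (IteratedWreath S n))).preimage hc
  iInf_term := by
    rw [eq_bot_iff]
    intro g hg
    rw [Subgroup.mem_iInf] at hg
    exact Subtype.ext (funext fun n => hg n)

/-- A sequence of finite permutation groups is good if there are a constant `A > 0` and `M₀` with
`|Sₖ| ≤ |Sₖ₊₁|^A` for all `k ≥ M₀`. -/
def IsGoodSequence (S : ∀ k, Subgroup (Equiv.Perm (Ω k))) : Prop :=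
  ∃ A : ℝ, 0 < A ∧ ∃ M₀ : ℕ, ∀ k ≥ M₀,
    (Nat.card (S k) : ℝ) ≤ (Nat.card (S (k + 1)) : ℝ) ^ A

end IteratedWreathProduct

/-- A permutation group that is transitive, non-abelian and simple. -/
structure IsNonabelianSimpleTransitive {Ω : Type*} (A : Subgroup (Equiv.Perm Ω)) : Prop where
  isPretransitive : MulAction.IsPretransitive A Ω
  isSimpleGroup : IsSimpleGroup A
  not_comm : ¬ ∀ a b : A, a * b = b * a

/-! ### Invariant subsets of prescribed size. -/

section InvariantSets

/-! Write Λₙ for the set on which Wₙ acts. The two properties are proved independently.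

Just infiniteness: let K be a non-trivial closed subgroup normalised by some Nₙ; this covers closed
normal subgroups of an open subgroup, since the latter contains some Nₙ. For large m an element of K
is non-trivial in Wₘ₊₁ and moves a point l of Λₘ₊₁. Commutators with the base group of Wₘ₊₂ then
give, by simplicity, the whole coordinate subgroup at l (`mulSingle_mem_of_act_ne`). The base group
of Wₘ₊₁ is transitive on Λₘ₊₁ and trivial in Wₘ, so conjugation by it yields every coordinate
(`exists_apply_eq_wreathBase`). Hence K covers almost all layers and, being closed, is open
(`isOpen_of_wreathBase_mem_map`).

Spectrum: dimension 1 is that of the whole group. For d < 1 put Hₙ₊₁ = Sₙ₊₁^{Xₙ} ⋊ Hₙ, where Xₙ ⊆ Λₙ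
is a largest Hₙ-invariant set of density at most d. The density falls short of d by at most the
relative size of the longest Hₙ-orbit. This error vanishes: orbits of Hₙ₊₁ have at most |Hₙ|
|Ωₙ₊₁|^{|Xₙ|} points out of |Ωₙ₊₁|^{|Λₙ|}, and log |Wₙ| = o(|Λₙ|) (`tendsto_log_card_div_card_pt`).
By the same estimate the top layer dominates both log |Hₙ₊₁| and log |Wₙ₊₁|, so their ratio also
tends to d. -/

/-- A finite set with a group action contains an invariant subset whose cardinality approximates
any given number from below, up to the size of an orbit. -/
theorem exists_invariant_ncard_le {B : ActingGroup.{u}} [Finite B.pt] (H : Subgroup B.grp)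
    {D : ℝ} (hD : 0 ≤ D) (hD' : D ≤ Nat.card B.pt) :
    ∃ X : Set B.pt, (∀ h ∈ H, ∀ l ∈ X, B.act h l ∈ X) ∧ (X.ncard : ℝ) ≤ D ∧
      ∀ M : ℕ, (∀ l : B.pt, {m | ∃ h ∈ H, B.act h l = m}.ncard ≤ M) → D ≤ X.ncard + M := by
  classical
  let P : Set (Set B.pt) := {X | (∀ h ∈ H, ∀ l ∈ X, B.act h l ∈ X) ∧ (X.ncard : ℝ) ≤ D}
  obtain ⟨X, hX, hmax⟩ := Set.exists_max_image P Set.ncard P.toFinite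
    ⟨∅, by simp [P, hD]⟩
  refine ⟨X, hX.1, hX.2, fun M hM => ?_⟩
  by_cases hXu : X = Set.univ
  · rw [hXu, Set.ncard_univ]
    have : (0 : ℝ) ≤ M := Nat.cast_nonneg M
    linarith
  obtain ⟨l, hl⟩ := (Set.ne_univ_iff_exists_notMem X).1 hXu
  by_contra! hlt
  let O : Set B.pt := {m | ∃ h ∈ H, B.act h l = m}
  have hlO : l ∈ O := ⟨1, H.one_mem, by simp⟩
  -- If the bound failed, adding the orbit of a missing point would keep the set invariant and
  -- within size `D`, against maximality.
  have hcard : (X ∪ O).ncard ≤ X.ncard + M :=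
    (Set.ncard_union_le X O).trans (Nat.add_le_add_left (hM l) _)
  have hmem : X ∪ O ∈ P := by
    refine ⟨?_, ?_⟩
    · rintro h hh m (hm | ⟨h', hh', rfl⟩)
      · exact Or.inl (hX.1 h hh m hm)
      · exact Or.inr ⟨h * h', H.mul_mem hh hh', by simp⟩
    · have : ((X ∪ O).ncard : ℝ) ≤ X.ncard + M := by exact_mod_cast hcard
      linarith
  have hss : X ⊂ X ∪ O :=
    ⟨Set.subset_union_left, fun h => hl (h (Or.inr hlO))⟩
  exact absurd (hmax _ hmem) (not_le.2 (Set.ncard_lt_ncard hss))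

end InvariantSets

/-! ### Subgroups of a single wreath product. -/

section WreathSubgroups

variable {Ω : Type u} (A : Subgroup (Equiv.Perm Ω)) (B : ActingGroup.{u})

@[simp]
theorem permuteCoords_apply (b : B.grp) (a : B.pt → A) (l : B.pt) :
    permuteCoords A B b a l = a ((B.act b)⁻¹ l) := rfl

/-- The subgroup `A^X ⋊ H` of `A ≀ B`, for an `H`-invariant set `X`. -/
def wreathSubgroup (H : Subgroup B.grp) (X : Set B.pt) (hX : ∀ h ∈ H, ∀ l ∈ X, B.act h l ∈ X) :
    Subgroup (productWreath A B).grp where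
  carrier := {g : (B.pt → A) ⋊[permuteCoords A B] B.grp | g.right ∈ H ∧ ∀ l ∉ X, g.left l = 1}
  one_mem' := ⟨H.one_mem, fun _ _ => rfl⟩
  mul_mem' := by
    rintro g h ⟨hg, hg'⟩ ⟨hh, hh'⟩
    refine ⟨H.mul_mem hg hh, fun l hl => ?_⟩
    have h₁ : (B.act g.right)⁻¹ l ∉ X := fun hm => hl (by simpa using hX _ hg _ hm)
    change g.left l * h.left ((B.act g.right)⁻¹ l) = 1
    rw [hg' l hl, hh' _ h₁, mul_one]
  inv_mem' := by
    rintro g ⟨hg, hg'⟩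
    refine ⟨H.inv_mem hg, fun l hl => ?_⟩
    have h₁ : (B.act g.right⁻¹)⁻¹ l ∉ X := fun hm => hl (by simpa using hX _ (H.inv_mem hg) _ hm)
    change (g.left ((B.act g.right⁻¹)⁻¹ l))⁻¹ = 1
    rw [hg' _ h₁, inv_one]

variable {A B}

theorem card_wreathSubgroup [Finite B.pt] (H : Subgroup B.grp) (X : Set B.pt)
    (hX : ∀ h ∈ H, ∀ l ∈ X, B.act h l ∈ X) :
    Nat.card (wreathSubgroup A B H X hX) = Nat.card A ^ X.ncard * Nat.card H := by
  classical
  let e : wreathSubgroup A B H X hX ≃ (X → A) × H :=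
    { toFun := fun g => (fun l => g.1.left l, ⟨g.1.right, g.2.1⟩)
      invFun := fun p => ⟨(⟨fun l => if h : l ∈ X then p.1 ⟨l, h⟩ else 1, p.2.1⟩ :
          (B.pt → A) ⋊[permuteCoords A B] B.grp),
        p.2.2, fun l hl => dif_neg hl⟩
      left_inv := fun g => Subtype.ext <| SemidirectProduct.ext
        (funext fun l => by
          by_cases h : l ∈ X
          · simp [h]
          · simpa [h] using (g.2.2 l h).symm) rfl
      right_inv := fun p => by ext <;> simp }
  rw [Nat.card_congr e, Nat.card_prod, Nat.card_fun, Nat.card_coe_set_eq]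

theorem card_productWreath [Finite B.pt] :
    Nat.card (productWreath A B).grp = Nat.card A ^ Nat.card B.pt * Nat.card B.grp := by
  rw [← Nat.card_fun, ← Nat.card_prod]
  exact Nat.card_congr SemidirectProduct.equivProd

/-- Outside `X` the image of `f` depends only on the component in `H`; on `X` it is one of the
functions `X → Ω`. -/
theorem ncard_orbit_wreathSubgroup_le [Finite Ω] [Finite B.pt] [Finite B.grp]
    (H : Subgroup B.grp) (X : Set B.pt) (hX : ∀ h ∈ H, ∀ l ∈ X, B.act h l ∈ X)
    (f : (productWreath A B).pt) :
    {f' | ∃ g ∈ wreathSubgroup A B H X hX, (productWreath A B).act g f = f'}.ncard ≤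
      Nat.card H * Nat.card Ω ^ X.ncard := by
  classical
  let Φ : H × (X → Ω) → (B.pt → Ω) := fun p l =>
    if h : l ∈ X then p.2 ⟨l, h⟩ else (show B.pt → Ω from f) ((B.act p.1)⁻¹ l)
  have hsub : {f' | ∃ g ∈ wreathSubgroup A B H X hX, (productWreath A B).act g f = f'} ⊆
      Set.range Φ := by
    rintro f' ⟨g, hg, rfl⟩
    refine ⟨(⟨g.right, hg.1⟩,
      fun l => (show B.pt → Ω from (productWreath A B).act g f) l), funext fun l => ?_⟩
    by_cases h : l ∈ X
    · simp [Φ, h]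
    · have h₁ : (productWreath A B).act g f l =
        (g.left l : Equiv.Perm Ω) ((show B.pt → Ω from f) ((B.act g.right)⁻¹ l)) := rfl
      rw [h₁, hg.2 l h]
      simp [Φ, h]
  calc _ ≤ (Set.range Φ).ncard := Set.ncard_le_ncard hsub (Set.toFinite (α := B.pt → Ω) _)
    _ ≤ Nat.card (H × (X → Ω)) := by
      rw [← Nat.card_coe_set_eq]
      exact Finite.card_range_le Φ
    _ = _ := by rw [Nat.card_prod, Nat.card_fun, Nat.card_coe_set_eq]

/-- A subgroup of `A ≀ B` normalised by the base group, with an element that moves a point `l`,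
contains the coordinate subgroup at `l`. -/
theorem mulSingle_mem_of_act_ne [DecidableEq B.pt] [IsSimpleGroup A]
    (hA : ¬ ∀ a b : A, a * b = b * a)
    {K : Subgroup ((B.pt → A) ⋊[permuteCoords A B] B.grp)}
    (hK : ∀ a : B.pt → A, ∀ k ∈ K,
      SemidirectProduct.inl a * k * (SemidirectProduct.inl a)⁻¹ ∈ K)
    {k : (B.pt → A) ⋊[permuteCoords A B] B.grp} (hk : k ∈ K) {l : B.pt}
    (hl : B.act k.right l ≠ l) (s : A) :
    SemidirectProduct.inl (Pi.mulSingle l s) ∈ K := by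
  have hl' : (B.act k.right)⁻¹ l ≠ l := fun h => hl (by
    conv_lhs => rw [← h]
    simp)
  let N : Subgroup A := K.comap (SemidirectProduct.inl.comp (MonoidHom.mulSingle (fun _ => A) l))
  have hN : N.Normal := ⟨fun n hn g => by
    have := hK (Pi.mulSingle l g) _ hn
    simpa [N, Pi.mulSingle_mul, Pi.mulSingle_inv] using this⟩
  push Not at hA
  obtain ⟨a, b, hab⟩ := hA
  have hcomm : a * b * a⁻¹ * b⁻¹ ∈ N := by
    -- This is the commutator of `Pi.mulSingle l a` with `k`. Its second factor is supported at the
    -- image of `l` under `k`, which is not `l`, so `c l = a`.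
    let c : B.pt → A := Pi.mulSingle l a * (k.left *
      permuteCoords A B k.right (Pi.mulSingle l a)⁻¹ * k.left⁻¹)
    have hc : SemidirectProduct.inl c ∈ K := by
      have h := K.mul_mem (hK (Pi.mulSingle l a) k hk) (K.inv_mem hk)
      convert h using 1
      refine SemidirectProduct.ext ?_ ?_
      · simp [c, mul_assoc]
      · simp
    have hcl : c l = a := by
      simp [c, Pi.mulSingle_eq_of_ne (show (B.act k.right).symm l ≠ l from hl')]
    have h := K.mul_mem hc (hK (Pi.mulSingle l b) _ (K.inv_mem hc))
    -- A second commutator, with an element supported at `l`, removes all other coordinates of `c`.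
    have heq : SemidirectProduct.inl c * (SemidirectProduct.inl (Pi.mulSingle l b) *
        (SemidirectProduct.inl c)⁻¹ * (SemidirectProduct.inl (Pi.mulSingle l b))⁻¹) =
        (SemidirectProduct.inl (Pi.mulSingle l (a * b * a⁻¹ * b⁻¹)) :
          (B.pt → A) ⋊[permuteCoords A B] B.grp) := by
      simp only [← map_inv, ← map_mul]
      congr 1
      funext m
      by_cases hm : m = l
      · subst hm
        simp [hcl, mul_assoc]
      · simp [Pi.mulSingle_eq_of_ne hm]
    rw [heq] at h
    exact h
  rcases hN.eq_bot_or_eq_top with h | h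
  · rw [h, Subgroup.mem_bot] at hcomm
    exact absurd (by simpa [mul_inv_eq_iff_eq_mul] using hcomm) hab
  · have : s ∈ N := h ▸ Subgroup.mem_top s
    exact this

theorem inr_mul_inl_mulSingle_mul_inv [DecidableEq B.pt] (r : B.grp) (l : B.pt) (s : A) :
    (SemidirectProduct.inr r * SemidirectProduct.inl (Pi.mulSingle l s) *
      (SemidirectProduct.inr r)⁻¹ : (B.pt → A) ⋊[permuteCoords A B] B.grp) =
      SemidirectProduct.inl (Pi.mulSingle (B.act r l) s) := by
  rw [← map_inv, ← SemidirectProduct.inl_aut]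
  congr 1
  funext m
  simp only [permuteCoords_apply, Pi.mulSingle_apply]
  congr 1
  rw [Equiv.Perm.inv_eq_iff_eq]

/-- For a transitive group `A`, the base group of `A ≀ B` is transitive. -/
theorem exists_inl_act_eq [MulAction.IsPretransitive A Ω] (f f' : (productWreath A B).pt) :
    ∃ a : B.pt → A, (productWreath A B).act
      (SemidirectProduct.inl a : (B.pt → A) ⋊[permuteCoords A B] B.grp) f = f' := by
  choose a ha using fun l => MulAction.exists_smul_eq A
    ((show B.pt → Ω from f) l) ((show B.pt → Ω from f') l)
  refine ⟨a, funext fun l => ?_⟩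
  have : (productWreath A B).act
      (SemidirectProduct.inl a : (B.pt → A) ⋊[permuteCoords A B] B.grp) f l =
      (a l : Equiv.Perm Ω) ((show B.pt → Ω from f) ((B.act 1)⁻¹ l)) := rfl
  rw [this, map_one, inv_one]
  exact ha l

end WreathSubgroups

/-! ### Lifting to the inverse limit, and its topology. -/

section Limit

variable {Ω : ℕ → Type u} (S : ∀ k, Subgroup (Equiv.Perm (Ω k)))

/-- The natural section `Wₙ → Wₙ₊₁` of the projection. -/
def wreathSection (n : ℕ) : IteratedWreath S n →* IteratedWreath S (n + 1) :=
  SemidirectProduct.inr (φ := permuteCoords (S (n + 1)) (iteratedStage S n))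

/-- The embedding of the base group into `Wₙ₊₁`. -/
def wreathBase (n : ℕ) : ((iteratedStage S n).pt → S (n + 1)) →* IteratedWreath S (n + 1) :=
  SemidirectProduct.inl (φ := permuteCoords (S (n + 1)) (iteratedStage S n))

@[simp]
theorem wreathProj_wreathSection (n : ℕ) (w : IteratedWreath S n) :
    wreathProj S n (wreathSection S n w) = w := rfl

theorem exists_wreathBase_eq {n : ℕ} {w : IteratedWreath S (n + 1)} (hw : wreathProj S n w = 1) :
    ∃ a, wreathBase S n a = w :=
  ⟨SemidirectProduct.left w, SemidirectProduct.ext rfl hw.symm⟩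

variable {S}

/-- An element of a term of a compatible system of subgroups, closed under the natural sections,
lifts to the inverse limit of this system. -/
theorem exists_mem_wreathLimit {H : ∀ n, Subgroup (IteratedWreath S n)}
    (hproj : ∀ n, ∀ w ∈ H (n + 1), wreathProj S n w ∈ H n)
    (hsec : ∀ n, ∀ w ∈ H n, wreathSection S n w ∈ H (n + 1)) {m : ℕ} {w : IteratedWreath S m}
    (hw : w ∈ H m) : ∃ g ∈ wreathLimit S, (∀ n, g n ∈ H n) ∧ g m = w := by
  -- Up to `m` the components are forced by projecting `w`; those above `m` are placeholders.
  have hdown : ∃ g : ∀ n, IteratedWreath S n, (∀ n ≤ m, g n ∈ H n) ∧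
      (∀ n < m, wreathProj S n (g (n + 1)) = g n) ∧ g m = w := by
    induction m with
    | zero =>
      refine ⟨Function.update 1 0 w, fun n hn => ?_, fun n hn => absurd hn (by omega), by simp⟩
      obtain rfl : n = 0 := by omega
      simpa using hw
    | succ m ih =>
      obtain ⟨g, h₁, h₂, h₃⟩ := ih (hproj m w hw)
      refine ⟨Function.update g (m + 1) w, fun n hn => ?_, fun n hn => ?_, by simp⟩
      · rcases Nat.le_succ_iff.1 hn with h | rfl
        · rw [Function.update_of_ne (by omega)]
          exact h₁ n h
        · simpa using hw
      · rcases Nat.lt_succ_iff_lt_or_eq.1 hn with h | rfl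
        · rw [Function.update_of_ne (by omega), Function.update_of_ne (by omega)]
          exact h₂ n h
        · rw [Function.update_self, Function.update_of_ne (by omega), h₃]
  obtain ⟨g, h₁, h₂, h₃⟩ := hdown
  -- Above `m` the placeholders are replaced by iterated sections.
  let g' : ∀ n, IteratedWreath S n := fun n => Nat.rec (motive := fun n => IteratedWreath S n)
    (g 0) (fun n x => if n + 1 ≤ m then g (n + 1) else wreathSection S n x) n
  have hsucc : ∀ n, g' (n + 1) = if n + 1 ≤ m then g (n + 1) else wreathSection S n (g' n) :=
    fun _ => rfl
  have hle : ∀ n ≤ m, g' n = g n := by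
    rintro (_ | n) hn
    · rfl
    · rw [hsucc, if_pos hn]
  refine ⟨g', fun n => ?_, fun n => ?_, by rw [hle m le_rfl, h₃]⟩
  · rw [hsucc]
    split_ifs with h
    · rw [h₂ n h, hle n (by omega)]
    · simp
  · induction n with
    | zero => exact h₁ 0 (Nat.zero_le m)
    | succ n ih =>
      rw [hsucc]
      split_ifs with h
      · exact h₁ _ h
      · exact hsec n _ ih

variable (S) in
theorem exists_wreathLimit_apply_eq (m : ℕ) (w : IteratedWreath S m) :
    ∃ g : wreathLimit S, g.1 m = w := by
  obtain ⟨g, hg, -, h⟩ := exists_mem_wreathLimit (S := S) (H := fun _ => ⊤)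
    (fun _ _ _ => trivial) (fun _ _ _ => trivial) (m := m) (w := w) trivial
  exact ⟨⟨g, hg⟩, h⟩

theorem wreathLimit_apply_eq_of_le {g h : wreathLimit S} {m n : ℕ} (hmn : m ≤ n)
    (hgh : g.1 n = h.1 n) : g.1 m = h.1 m := by
  induction n, hmn using Nat.le_induction with
  | base => exact hgh
  | succ n _ ih => exact ih (by rw [← g.2 n, ← h.2 n, hgh])

variable [∀ k, Finite (Ω k)]

/-- The cosets of the kernels Nₙ at `g` are closed, decrease and meet only in `g`; by compactness
one of them lies in the given neighbourhood. -/
theorem exists_wreathLimit_nhds {g : wreathLimit S} {U : Set (wreathLimit S)} (hU : U ∈ nhds g) :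
    ∃ n, ∀ h : wreathLimit S, h.1 n = g.1 n → h ∈ U := by
  let V : ℕ → Set (wreathLimit S) := fun n => {h | h.1 n = g.1 n}
  have hV : ∀ n, IsClosed (V n) := fun n =>
    isClosed_eq ((continuous_apply n).comp continuous_subtype_val) continuous_const
  have hdir : Directed (· ⊇ ·) V :=
    (antitone_nat_of_succ_le fun n h hh =>
      wreathLimit_apply_eq_of_le (Nat.le_succ n) hh : Antitone V).directed_ge
  obtain ⟨n, hn⟩ := exists_subset_nhds_of_compactSpace hdir hV (U := U) fun h hh => by
    have : h = g := Subtype.ext (funext fun n => Set.mem_iInter.1 hh n)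
    rwa [this]
  exact ⟨n, fun h hh => hn hh⟩

theorem isOpen_of_forall_apply_eq_one_mem {K : Subgroup (wreathLimit S)} {n : ℕ}
    (hK : ∀ g : wreathLimit S, g.1 n = 1 → g ∈ K) : IsOpen (K : Set (wreathLimit S)) := by
  refine Subgroup.isOpen_mono (H₁ := ((levelFiltration S).term n : Subgroup (wreathLimit S)))
    (fun g hg => hK g hg) ((levelFiltration S).isOpen_term n)

/-- A closed subgroup that covers almost all factors of the filtration is open. -/
theorem isOpen_of_wreathBase_mem_map {K : Subgroup (wreathLimit S)}
    (hKc : IsClosed (K : Set (wreathLimit S))) {m : ℕ}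
    (hK : ∀ n ≥ m, ∀ a, ∃ k ∈ K, k.1 (n + 1) = wreathBase S n a) :
    IsOpen (K : Set (wreathLimit S)) := by
  refine isOpen_of_forall_apply_eq_one_mem (n := m) fun g hg => ?_
  -- An approximation of `g` at one level is corrected at the next by an element of `K` from the
  -- base group.
  have key : ∀ n ≥ m, ∃ k ∈ K, k.1 n = g.1 n := by
    intro n hn
    induction n, hn using Nat.le_induction with
    | base => exact ⟨1, K.one_mem, hg.symm⟩
    | succ n hn ih =>
      obtain ⟨k, hk, hkg⟩ := ih
      have h₁ : wreathProj S n ((k.1 (n + 1))⁻¹ * g.1 (n + 1)) = 1 := by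
        rw [map_mul, map_inv, k.2 n, g.2 n, hkg, inv_mul_cancel]
      obtain ⟨a, ha⟩ := exists_wreathBase_eq S h₁
      obtain ⟨k', hk', hka⟩ := hK n hn a
      refine ⟨k * k', K.mul_mem hk hk', ?_⟩
      rw [Subgroup.coe_mul, Pi.mul_apply, hka, ha, mul_inv_cancel_left]
  have hmem : g ∈ closure (K : Set (wreathLimit S)) := by
    rw [mem_closure_iff_nhds]
    intro U hU
    obtain ⟨n, hn⟩ := exists_wreathLimit_nhds hU
    obtain ⟨k, hk, hkg⟩ := key (max m n) (le_max_left _ _)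
    exact ⟨k, hn k (wreathLimit_apply_eq_of_le (le_max_right _ _) hkg), hk⟩
  rwa [hKc.closure_eq] at hmem

end Limit

/-! ### Hereditary just infiniteness. -/

section JustInfinite

variable {Ω : ℕ → Type u} {S : ∀ k, Subgroup (Equiv.Perm (Ω k))}

theorem IsNonabelianSimpleTransitive.nontrivial {Ω : Type*} {A : Subgroup (Equiv.Perm Ω)}
    (hA : IsNonabelianSimpleTransitive A) : Nontrivial Ω := by
  by_contra h
  rw [not_nontrivial_iff_subsingleton] at h
  exact hA.not_comm fun a b => Subsingleton.elim _ _

theorem IsNonabelianSimpleTransitive.two_le_card {Ω : Type*} [Finite Ω]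
    {A : Subgroup (Equiv.Perm Ω)} (hA : IsNonabelianSimpleTransitive A) : 2 ≤ Nat.card A :=
  have := hA.isSimpleGroup
  Finite.one_lt_card

/-- If a subgroup normalised by the kernel of `W^pa(S) → Wₘ` has a non-trivial image in `Wₘ₊₁`,
then its image in `Wₘ₊₂` contains the base group. -/
theorem exists_apply_eq_wreathBase [∀ k, Finite (Ω k)]
    (hS : ∀ k, IsNonabelianSimpleTransitive (S k))
    {K : Subgroup (wreathLimit S)} {m : ℕ}
    (hK : ∀ g : wreathLimit S, g.1 m = 1 → ∀ k ∈ K, g * k * g⁻¹ ∈ K) {k : wreathLimit S}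
    (hk : k ∈ K) (hk1 : k.1 (m + 1) ≠ 1) (a : (iteratedStage S (m + 1)).pt → S (m + 2)) :
    ∃ k ∈ K, k.1 (m + 2) = wreathBase S (m + 1) a := by
  classical
  have := fun k => (hS k).nontrivial
  have := (hS (m + 2)).isSimpleGroup
  have := (hS (m + 1)).isPretransitive
  have := (iteratedStage_finite S (m + 1)).1
  let L : Subgroup (IteratedWreath S (m + 2)) :=
    K.map ((Pi.evalMonoidHom (fun n => IteratedWreath S n) (m + 2)).comp (wreathLimit S).subtype)
  let K' : Subgroup (((iteratedStage S (m + 1)).pt → S (m + 2))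
      ⋊[permuteCoords (S (m + 2)) (iteratedStage S (m + 1))] (iteratedStage S (m + 1)).grp) := L
  have hmem : k.1 (m + 2) ∈ L := ⟨k, hk, rfl⟩
  -- Elements of Wₘ₊₂ trivial in Wₘ lift to the kernel Nₘ, which normalises `K`.
  have hconj : ∀ w, wreathProj S m (wreathProj S (m + 1) w) = 1 →
      ∀ x ∈ L, w * x * w⁻¹ ∈ L := by
    rintro w hw _ ⟨x, hx, rfl⟩
    obtain ⟨g, hg⟩ := exists_wreathLimit_apply_eq S (m + 2) w
    refine ⟨g * x * g⁻¹, hK g ?_ x hx, ?_⟩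
    · rw [← g.2 m, ← g.2 (m + 1), hg, hw]
    · rw [← hg]
      simp
  have hne : (iteratedStage S (m + 1)).act (k.1 (m + 1)) ≠ 1 := fun h =>
    hk1 (iteratedStage_act_injective S (m + 1) (h.trans (map_one _).symm))
  obtain ⟨l, hl⟩ : ∃ l, (iteratedStage S (m + 1)).act (k.1 (m + 1)) l ≠ l := by
    by_contra! h
    exact hne (Equiv.ext h)
  have hsingle : ∀ s, SemidirectProduct.inl (Pi.mulSingle l s) ∈ K' := by
    refine mulSingle_mem_of_act_ne (hS (m + 2)).not_comm (fun b x hx => ?_)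
      (k := k.1 (m + 2)) hmem ?_
    · exact hconj (SemidirectProduct.inl b) (map_one _) x hx
    · have : (SemidirectProduct.right (k.1 (m + 2)) : (iteratedStage S (m + 1)).grp) =
        k.1 (m + 1) := k.2 (m + 1)
      rw [this]
      exact hl
  have hall : ∀ l' s, SemidirectProduct.inl (Pi.mulSingle l' s) ∈ K' := by
    intro l' s
    obtain ⟨b, hb⟩ := exists_inl_act_eq (A := S (m + 1)) (B := iteratedStage S m) l l'
    have hb' : (iteratedStage S (m + 1)).act (wreathBase S m b) l = l' := hb
    have := inr_mul_inl_mulSingle_mul_inv (A := S (m + 2)) (B := iteratedStage S (m + 1))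
      (wreathBase S m b) l s
    rw [hb'] at this
    rw [← this]
    exact hconj (wreathSection S (m + 1) (wreathBase S m b)) rfl _ (hsingle s)
  have := Subgroup.pi_mem_of_mulSingle_mem (H := K'.comap SemidirectProduct.inl) a
    fun l' => hall l' (a l')
  exact this

theorem isOpen_of_isClosed_of_conj_mem [∀ k, Finite (Ω k)]
    (hS : ∀ k, IsNonabelianSimpleTransitive (S k))
    {K : Subgroup (wreathLimit S)} (hKc : IsClosed (K : Set (wreathLimit S))) (hK1 : K ≠ ⊥)
    {n : ℕ} (hK : ∀ g : wreathLimit S, g.1 n = 1 → ∀ k ∈ K, g * k * g⁻¹ ∈ K) :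
    IsOpen (K : Set (wreathLimit S)) := by
  obtain ⟨k, hk, hk1⟩ := Subgroup.ne_bot_iff_exists_ne_one.1 hK1 |> fun ⟨k, h⟩ =>
    (⟨k, k.2, fun h' => h (Subtype.ext h')⟩ : ∃ k : wreathLimit S, k ∈ K ∧ k ≠ 1)
  obtain ⟨i, hi⟩ : ∃ i, k.1 i ≠ 1 := by
    by_contra! h
    exact hk1 (Subtype.ext (funext h))
  -- The shift by one pays for the two levels consumed: normalisation by the kernel at `m` and
  -- non-triviality at `m + 1` give the base group at `m + 2`.
  refine isOpen_of_wreathBase_mem_map hKc (m := max i n + 1) fun m hm => ?_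
  obtain ⟨m, rfl⟩ : ∃ m', m = m' + 1 := ⟨m - 1, by omega⟩
  have him : i ≤ m + 1 := by omega
  have hnm : n ≤ m := by omega
  exact exists_apply_eq_wreathBase hS
    (fun g hg => hK g (wreathLimit_apply_eq_of_le (h := 1) hnm hg)) hk
    fun h => hi (wreathLimit_apply_eq_of_le (h := 1) him h)

theorem card_iteratedWreath_succ [∀ k, Finite (Ω k)] (S : ∀ k, Subgroup (Equiv.Perm (Ω k)))
    (n : ℕ) : Nat.card (IteratedWreath S (n + 1)) =
      Nat.card (S (n + 1)) ^ Nat.card (iteratedStage S n).pt * Nat.card (IteratedWreath S n) :=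
  have := (iteratedStage_finite S n).1
  card_productWreath

theorem card_pt_succ [∀ k, Finite (Ω k)] (S : ∀ k, Subgroup (Equiv.Perm (Ω k))) (n : ℕ) :
    Nat.card (iteratedStage S (n + 1)).pt =
      Nat.card (Ω (n + 1)) ^ Nat.card (iteratedStage S n).pt :=
  have := (iteratedStage_finite S n).1
  Nat.card_fun

theorem add_two_le_card_pt [∀ k, Finite (Ω k)] [∀ k, Nontrivial (Ω k)]
    (S : ∀ k, Subgroup (Equiv.Perm (Ω k))) (n : ℕ) : n + 2 ≤ Nat.card (iteratedStage S n).pt := by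
  induction n with
  | zero => exact Finite.one_lt_card (α := Ω 0)
  | succ n ih =>
    rw [card_pt_succ]
    calc n + 1 + 2 ≤ 2 ^ (n + 2) := Nat.lt_two_pow_self
      _ ≤ 2 ^ Nat.card (iteratedStage S n).pt := Nat.pow_le_pow_right (by norm_num) ih
      _ ≤ _ := Nat.pow_le_pow_left (Finite.one_lt_card (α := Ω (n + 1))) _

theorem add_two_le_card_iteratedWreath [∀ k, Finite (Ω k)]
    (hS : ∀ k, IsNonabelianSimpleTransitive (S k)) (n : ℕ) :
    n + 2 ≤ Nat.card (IteratedWreath S n) := by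
  have := fun k => (hS k).nontrivial
  induction n with
  | zero => exact (hS 0).two_le_card
  | succ n ih =>
    rw [card_iteratedWreath_succ]
    have h : 2 ^ 1 ≤ Nat.card (S (n + 1)) ^ Nat.card (iteratedStage S n).pt :=
      (Nat.pow_le_pow_left (hS (n + 1)).two_le_card 1).trans
        (Nat.pow_le_pow_right (by have := (hS (n + 1)).two_le_card; omega)
          (by have := add_two_le_card_pt S n; omega))
    nlinarith

theorem infinite_wreathLimit [∀ k, Finite (Ω k)] (hS : ∀ k, IsNonabelianSimpleTransitive (S k)) :
    Infinite (wreathLimit S) := by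
  by_contra h
  rw [not_infinite_iff_finite] at h
  have h₁ := add_two_le_card_iteratedWreath hS (Nat.card (wreathLimit S))
  have h₂ := Nat.card_le_card_of_surjective (fun g : wreathLimit S => g.1 (Nat.card (wreathLimit S)))
    (exists_wreathLimit_apply_eq S _)
  omega

theorem isHereditarilyJustInfinite_wreathLimit [∀ k, Finite (Ω k)]
    (hS : ∀ k, IsNonabelianSimpleTransitive (S k)) :
    IsHereditarilyJustInfinite (wreathLimit S) := by
  have hinf := infinite_wreathLimit hS
  refine ⟨⟨hinf, fun N hN hNc hN1 => isOpen_of_isClosed_of_conj_mem hS hNc hN1 (n := 0)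
    fun g _ k hk => hN.conj_mem k hk g⟩, fun H hH => ⟨?_, fun N hN hNc hN1 => ?_⟩⟩
  · by_contra h
    rw [not_infinite_iff_finite] at h
    have := H.quotient_finite_of_isOpen hH
    exact not_finite_iff_infinite.2 hinf (Finite.of_equiv _ H.groupEquivQuotientProdSubgroup.symm)
  · have hHc : IsClosed (H : Set (wreathLimit S)) := H.isClosed_of_isOpen hH
    -- The open subgroup `H` contains a kernel Nₙ, which therefore normalises every normal subgroup
    -- of `H`.
    obtain ⟨n, hn⟩ := exists_wreathLimit_nhds (hH.mem_nhds H.one_mem)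
    have hcoe : ((N.map H.subtype : Subgroup (wreathLimit S)) : Set (wreathLimit S)) =
      Subtype.val '' (N : Set H) := rfl
    have hopen : IsOpen ((N.map H.subtype : Subgroup (wreathLimit S)) : Set (wreathLimit S)) := by
      refine isOpen_of_isClosed_of_conj_mem hS (n := n) ?_ ?_ ?_
      · rw [hcoe]
        exact hHc.isClosedEmbedding_subtypeVal.isClosedMap _ hNc
      · rwa [Ne, Subgroup.map_eq_bot_iff_of_injective _ H.subtype_injective]
      · rintro g hg _ ⟨k, hk, rfl⟩
        exact ⟨⟨g, hn g hg⟩ * k * ⟨g, hn g hg⟩⁻¹, hN.conj_mem k hk _, rfl⟩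
    have := hopen.preimage (continuous_subtype_val (p := (· ∈ H)))
    rwa [hcoe, Set.preimage_image_eq _ Subtype.val_injective] at this

end JustInfinite

/-! ### Growth of the groups Wₙ against the sets Λₙ. -/

section Growth

open Filter Topology

variable {Ω : ℕ → Type u} [∀ k, Finite (Ω k)] (S : ∀ k, Subgroup (Equiv.Perm (Ω k)))

theorem tendsto_card_pt [∀ k, Nontrivial (Ω k)] :
    Tendsto (fun n => (Nat.card (iteratedStage S n).pt : ℝ)) atTop atTop :=
  tendsto_natCast_atTop_atTop.comp <| tendsto_atTop_mono
    (fun n => (Nat.le_add_right n 2).trans (add_two_le_card_pt S n)) tendsto_id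

/-- A crude bound from |Ω|! ≤ |Ω|^|Ω| and log x ≤ x; a quadratic one suffices because |Λₙ₊₁| is the
|Λₙ|-th power of |Ωₙ₊₁|. -/
theorem log_card_subgroup_perm_le {Ω : Type*} [Finite Ω] [Nonempty Ω]
    (A : Subgroup (Equiv.Perm Ω)) :
    Real.log (Nat.card A) ≤ (Nat.card Ω : ℝ) ^ 2 := by
  have h₁ : Nat.card A ≤ Nat.card Ω ^ Nat.card Ω := by
    refine (Subgroup.card_le_card_group A).trans ?_
    rw [Nat.card_perm]
    exact Nat.factorial_le_pow _
  have h₂ : (0 : ℝ) < Nat.card A := by exact_mod_cast Nat.card_pos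
  calc Real.log (Nat.card A) ≤ Real.log ((Nat.card Ω : ℝ) ^ Nat.card Ω) :=
        Real.log_le_log h₂ (by exact_mod_cast h₁)
    _ = Nat.card Ω * Real.log (Nat.card Ω) := Real.log_pow _ _
    _ ≤ Nat.card Ω * Nat.card Ω :=
        mul_le_mul_of_nonneg_left (Real.log_le_self (Nat.cast_nonneg _)) (Nat.cast_nonneg _)
    _ = _ := (sq _).symm

theorem log_card_iteratedWreath_succ (n : ℕ) :
    Real.log (Nat.card (IteratedWreath S (n + 1))) =
      Nat.card (iteratedStage S n).pt * Real.log (Nat.card (S (n + 1))) +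
        Real.log (Nat.card (IteratedWreath S n)) := by
  rw [card_iteratedWreath_succ, Nat.cast_mul, Nat.cast_pow, Real.log_mul, Real.log_pow]
  · exact pow_ne_zero _ (by exact_mod_cast Nat.card_pos.ne')
  · exact_mod_cast Nat.card_pos.ne'

/-- The quotient `log |Wₙ| / |Λₙ|`, where `Λₙ` is the set on which `Wₙ` acts, tends to `0`. -/
theorem tendsto_log_card_div_card_pt [∀ k, Nontrivial (Ω k)] :
    Tendsto (fun n => Real.log (Nat.card (IteratedWreath S n)) /
      Nat.card (iteratedStage S n).pt) atTop (𝓝 0) := by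
  set L : ℕ → ℕ := fun n => Nat.card (iteratedStage S n).pt with hL
  set w : ℕ → ℝ := fun n => Real.log (Nat.card (IteratedWreath S n)) / L n with hw
  set q : ℕ → ℝ := fun n => (L n : ℝ) / 2 ^ L n with hq
  have hL2 : ∀ n, 2 ≤ L n := fun n => by
    have := add_two_le_card_pt S n
    simp only [hL]
    omega
  have hw0 : ∀ n, 0 ≤ w n := fun n =>
    div_nonneg (Real.log_natCast_nonneg _) (Nat.cast_nonneg _)
  have hq0 : ∀ n, 0 ≤ q n := fun n => by positivity
  have hq2 : ∀ n, q n ≤ 1 / 2 := fun n => by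
    have h : ∀ k : ℕ, (k + 1) * 2 ≤ 2 ^ (k + 1) := fun k => by
      rw [pow_succ]
      exact Nat.mul_le_mul_right 2 Nat.lt_two_pow_self
    have h' : L n * 2 ≤ 2 ^ L n := by
      obtain ⟨k, hk⟩ : ∃ k, L n = k + 1 := ⟨L n - 1, by have := hL2 n; omega⟩
      rw [hk]
      exact h k
    rw [hq, div_le_div_iff₀ (by positivity) (by norm_num), one_mul]
    exact_mod_cast h'
  have hstep : ∀ n, w (n + 1) ≤ (w n + 4) * q n := fun n => by
    have ho : 2 ≤ Nat.card (Ω (n + 1)) := Finite.one_lt_card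
    have ho' : (2 : ℝ) ≤ Nat.card (Ω (n + 1)) := by exact_mod_cast ho
    have hLpos : (0 : ℝ) < L n := by exact_mod_cast (by have := hL2 n; omega : 0 < L n)
    have h₁ : (L (n + 1) : ℝ) = (Nat.card (Ω (n + 1)) : ℝ) ^ L n := by
      exact_mod_cast card_pt_succ S n
    have h₂ : Real.log (Nat.card (IteratedWreath S n)) = w n * L n := by
      rw [hw, div_mul_cancel₀ _ hLpos.ne']
    have h₃ := log_card_subgroup_perm_le (S (n + 1))
    have h₄ : (2 : ℝ) ^ L n ≤ (Nat.card (Ω (n + 1)) : ℝ) ^ L n :=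
      pow_le_pow_left₀ (by norm_num) ho' _
    -- Cancelling the square leaves 2^(L - 2) ≤ |Ω|^(L - 2); the 4 is 2².
    have h₅ : (Nat.card (Ω (n + 1)) : ℝ) ^ 2 * 2 ^ L n ≤ 4 * (Nat.card (Ω (n + 1)) : ℝ) ^ L n := by
      obtain ⟨k, hk⟩ : ∃ k, L n = k + 2 := ⟨L n - 2, by have := hL2 n; omega⟩
      rw [hk, pow_add, pow_add]
      have := pow_le_pow_left₀ (by norm_num) ho' k
      nlinarith [sq_nonneg (Nat.card (Ω (n + 1)) : ℝ)]
    have h₆ : w (n + 1) = (L n * Real.log (Nat.card (S (n + 1))) + w n * L n) /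
        (Nat.card (Ω (n + 1)) : ℝ) ^ L n := by
      rw [← h₁, ← h₂, ← log_card_iteratedWreath_succ]
    rw [h₆, hq, ← mul_div_assoc, div_le_div_iff₀ (by positivity) (by positivity)]
    calc (L n * Real.log (Nat.card (S (n + 1))) + w n * L n) * 2 ^ L n
        ≤ (L n * (Nat.card (Ω (n + 1)) : ℝ) ^ 2 + w n * L n) * 2 ^ L n := by gcongr
      _ = L n * ((Nat.card (Ω (n + 1)) : ℝ) ^ 2 * 2 ^ L n) + w n * L n * 2 ^ L n := by ring
      _ ≤ L n * (4 * (Nat.card (Ω (n + 1)) : ℝ) ^ L n) +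
          w n * L n * (Nat.card (Ω (n + 1)) : ℝ) ^ L n := by
        have := mul_nonneg (hw0 n) hLpos.le
        gcongr
      _ = _ := by ring
  -- As `q n ≤ 1 / 2`, a bound `C ≥ 4` on `w n` propagates: (C + 4) / 2 ≤ C.
  obtain ⟨C, hC⟩ : ∃ C : ℝ, ∀ n, w n ≤ C := by
    refine ⟨max (w 0) 4, fun n => ?_⟩
    induction n with
    | zero => exact le_max_left _ _
    | succ n ih =>
      have h4 := le_max_right (w 0) 4
      have := mul_le_mul_of_nonneg_left (hq2 n) (by linarith [hw0 n] : 0 ≤ w n + 4)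
      linarith [hstep n]
  have hqlim : Tendsto q atTop (𝓝 0) := by
    have h := tendsto_pow_const_div_const_pow_of_one_lt 1 (r := (2 : ℝ)) (by norm_num)
    have hLlim : Tendsto L atTop atTop := tendsto_natCast_atTop_iff.1 (tendsto_card_pt S)
    refine (h.comp hLlim).congr fun n => ?_
    simp [hq]
  refine (tendsto_add_atTop_iff_nat 1).1 ?_
  refine squeeze_zero (fun n => hw0 _) (fun n => (hstep n).trans
    (mul_le_mul_of_nonneg_right (add_le_add_left (hC n) 4) (hq0 n))) ?_
  simpa using hqlim.const_mul (C + 4)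

end Growth

/-! ### Subgroups of prescribed Hausdorff dimension. -/

section Spectrum

open Filter Topology

variable {Ω : ℕ → Type u} [∀ k, Finite (Ω k)] (S : ∀ k, Subgroup (Equiv.Perm (Ω k)))

/-- Since Nₙ is the kernel of a surjection onto Wₙ, the indices become orders of images in Wₙ. -/
theorem hausdorffDim_levelFiltration (H : Subgroup (infiniteWreath S)) :
    hausdorffDim (levelFiltration S) H = liminf (fun n =>
      Real.log (Nat.card (H.map (toIteratedWreath S n))) /
        Real.log (Nat.card (IteratedWreath S n))) atTop := by
  refine congrArg (fun f => liminf f atTop) (funext fun n => ?_)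
  have := (levelFiltration S).normal_term n
  have hsurj : Function.Surjective (toIteratedWreath S n) := exists_wreathLimit_apply_eq S n
  rw [Subgroup.relIndex_sup_right]
  change Real.log ((toIteratedWreath S n).ker.relIndex H) /
    Real.log ((toIteratedWreath S n).ker.index) = _
  rw [Subgroup.relIndex_ker, Subgroup.index_ker, MonoidHom.range_eq_top.2 hsurj,
    Subgroup.card_top]

theorem hausdorffDim_levelFiltration_mem_Icc (H : Subgroup (infiniteWreath S)) :
    hausdorffDim (levelFiltration S) H ∈ Set.Icc (0 : ℝ) 1 := by
  rw [hausdorffDim_levelFiltration]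
  set r : ℕ → ℝ := fun n => Real.log (Nat.card (H.map (toIteratedWreath S n))) /
        Real.log (Nat.card (IteratedWreath S n))
  have h0 : ∀ n, 0 ≤ r n := fun n =>
    div_nonneg (Real.log_natCast_nonneg _) (Real.log_natCast_nonneg _)
  have h1 : ∀ n, r n ≤ 1 := fun n => by
    refine div_le_one_of_le₀ (Real.log_le_log ?_ ?_) (Real.log_natCast_nonneg _)
    · exact_mod_cast Nat.card_pos
    · exact_mod_cast Subgroup.card_le_card_group _
  refine ⟨le_liminf_of_le (isBoundedUnder_of ⟨1, h1⟩).isCoboundedUnder_ge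
    (Eventually.of_forall h0), liminf_le_of_le (isBoundedUnder_of ⟨0, h0⟩) fun b hb => ?_⟩
  obtain ⟨n, hn⟩ := hb.exists
  exact hn.trans (h1 n)

/-- A system of subgroups `Hₙ₊₁ = Sₙ₊₁^{Xₙ} ⋊ Hₙ`, where the density of the invariant set `Xₙ` is
`d` up to the size of the orbits of `Hₙ`. -/
theorem exists_sparse_subgroups {d : ℝ} (hd0 : 0 ≤ d) (hd1 : d ≤ 1) :
    ∃ (H : ∀ n, Subgroup (iteratedStage S n).grp) (X : ∀ n, Set (iteratedStage S n).pt)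
      (hX : ∀ n, ∀ h ∈ H n, ∀ l ∈ X n, (iteratedStage S n).act h l ∈ X n),
      (∀ n, H (n + 1) = wreathSubgroup (S (n + 1)) (iteratedStage S n) (H n) (X n) (hX n)) ∧
      (∀ n, ((X n).ncard : ℝ) ≤ d * Nat.card (iteratedStage S n).pt) ∧
      ∀ n, ∀ M : ℕ, (∀ l : (iteratedStage S n).pt,
        {m | ∃ h ∈ H n, (iteratedStage S n).act h l = m}.ncard ≤ M) →
          d * Nat.card (iteratedStage S n).pt ≤ (X n).ncard + M := by
  -- The invariant set is chosen for every subgroup at once, since Hₙ and Xₙ arise by a joint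
  -- recursion.
  have hex : ∀ n (H : Subgroup (iteratedStage S n).grp), _ := fun n H =>
    have := (iteratedStage_finite S n).1
    exists_invariant_ncard_le H (D := d * Nat.card (iteratedStage S n).pt) (by positivity)
      (mul_le_of_le_one_left (Nat.cast_nonneg _) hd1)
  choose Y hY hY₁ hY₂ using hex
  let H : ∀ n, Subgroup (iteratedStage S n).grp := fun n =>
    Nat.rec (motive := fun n => Subgroup (iteratedStage S n).grp) ⊥
      (fun n K => wreathSubgroup (S (n + 1)) (iteratedStage S n) K (Y n K) (hY n K)) n
  exact ⟨H, fun n => Y n (H n), fun n => hY n (H n), fun n => rfl, fun n => hY₁ n (H n),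
    fun n => hY₂ n (H n)⟩

/-- If the densities of the sets `Xₙ` tend to `d`, then so do the logarithmic densities of the
subgroups `Hₙ₊₁ = Sₙ₊₁^{Xₙ} ⋊ Hₙ`. -/
theorem tendsto_log_card_div_log_card (hS : ∀ k, IsNonabelianSimpleTransitive (S k))
    {H : ∀ n, Subgroup (iteratedStage S n).grp} {X : ∀ n, Set (iteratedStage S n).pt}
    {hX : ∀ n, ∀ h ∈ H n, ∀ l ∈ X n, (iteratedStage S n).act h l ∈ X n}
    (hH : ∀ n, H (n + 1) = wreathSubgroup (S (n + 1)) (iteratedStage S n) (H n) (X n) (hX n))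
    {d : ℝ} (hd : Tendsto (fun n => ((X n).ncard : ℝ) / Nat.card (iteratedStage S n).pt)
      atTop (𝓝 d)) :
    Tendsto (fun n => Real.log (Nat.card (H n)) / Real.log (Nat.card (IteratedWreath S n)))
      atTop (𝓝 d) := by
  have := fun k => (hS k).nontrivial
  have hfin := fun n => (iteratedStage_finite S n).1
  have hfin' := fun n => (iteratedStage_finite S n).2
  -- With x = |Xₙ|, l = |Λₙ| and s = log |Sₙ₊₁| ≥ log 2, both log |Hₙ| and log |Wₙ| lie between 0
  -- and e·l·s. Hence the ratio at `n + 1` is within `e n` of x / l.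
  set e : ℕ → ℝ := fun n => Real.log (Nat.card (IteratedWreath S n)) /
    Nat.card (iteratedStage S n).pt / Real.log 2 with he
  have helim : Tendsto e atTop (𝓝 0) := by
    simpa using (tendsto_log_card_div_card_pt S).div_const (Real.log 2)
  refine (tendsto_add_atTop_iff_nat 1).1 ?_
  have hlow := hd.sub helim
  have hupp := hd.add helim
  rw [sub_zero] at hlow
  rw [add_zero] at hupp
  refine tendsto_of_tendsto_of_tendsto_of_le_of_le hlow hupp (fun n => ?_) (fun n => ?_)
  all_goals
    have hL : (0 : ℝ) < Nat.card (iteratedStage S n).pt := by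
      exact_mod_cast (Nat.succ_pos _).trans_le (add_two_le_card_pt S n)
    have hl2 : 0 < Real.log 2 := Real.log_pos one_lt_two
    have hs : Real.log 2 ≤ Real.log (Nat.card (S (n + 1))) :=
      Real.log_le_log two_pos (by exact_mod_cast (hS (n + 1)).two_le_card)
    have hcard : Real.log (Nat.card (H (n + 1))) =
        (X n).ncard * Real.log (Nat.card (S (n + 1))) + Real.log (Nat.card (H n)) := by
      have h : Nat.card (H (n + 1)) = Nat.card (S (n + 1)) ^ (X n).ncard * Nat.card (H n) := by
        rw [hH]
        exact card_wreathSubgroup (H n) (X n) (hX n)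
      rw [h, Nat.cast_mul, Nat.cast_pow, Real.log_mul, Real.log_pow]
      · exact pow_ne_zero _ (by exact_mod_cast Nat.card_pos.ne')
      · exact_mod_cast Nat.card_pos.ne'
    have hXL : ((X n).ncard : ℝ) ≤ Nat.card (iteratedStage S n).pt := by
      rw [← Set.ncard_univ]
      exact_mod_cast Set.ncard_le_ncard (Set.subset_univ _) Set.finite_univ
    have hX0 : (0 : ℝ) ≤ (X n).ncard := Nat.cast_nonneg _
    have hHn : 0 ≤ Real.log (Nat.card (H n)) := Real.log_natCast_nonneg _
    have hW : 0 ≤ Real.log (Nat.card (IteratedWreath S n)) := Real.log_natCast_nonneg _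
    have hHW : Real.log (Nat.card (H n)) ≤ Real.log (Nat.card (IteratedWreath S n)) :=
      Real.log_le_log (by exact_mod_cast Nat.card_pos)
        (by exact_mod_cast Subgroup.card_le_card_group (H n))
    have hen : Real.log (Nat.card (IteratedWreath S n)) =
        e n * (Nat.card (iteratedStage S n).pt * Real.log 2) := by
      rw [he]
      field_simp
    have he0 : 0 ≤ e n := by positivity
    simp only [hcard, log_card_iteratedWreath_succ]
    set l := (Nat.card (iteratedStage S n).pt : ℝ)
    set x := ((X n).ncard : ℝ)
    set s := Real.log (Nat.card (S (n + 1)))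
    set W := Real.log (Nat.card (IteratedWreath S n))
    set K := Real.log (Nat.card (H n))
    have hs0 : 0 < s := hl2.trans_le hs
    have hW' : W ≤ e n * (l * s) := by
      rw [hen]
      gcongr
  · have h₁ : x / l * W ≤ e n * (l * s) := by
      have : x / l ≤ 1 := div_le_one_of_le₀ hXL hL.le
      nlinarith
    rw [le_div_iff₀ (by positivity)]
    have h₂ : x / l * (l * s) = x * s := by field_simp
    nlinarith [mul_nonneg he0 hW]
  · rw [div_le_iff₀ (by positivity)]
    have h₂ : x / l * (l * s) = x * s := by field_simp
    have h₃ : 0 ≤ x / l * W := by positivity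
    nlinarith [mul_nonneg he0 hW]

/-- The gap between `d` and the density is at most the longest orbit length divided by |Λₙ|; for `d
< 1` this quotient decays, as the set Xₙ₋₁ on which coordinates can vary freely misses a fixed
proportion of Λₙ₋₁. -/
theorem tendsto_ncard_div_card_pt (hS : ∀ k, IsNonabelianSimpleTransitive (S k))
    {H : ∀ n, Subgroup (iteratedStage S n).grp} {X : ∀ n, Set (iteratedStage S n).pt}
    {hX : ∀ n, ∀ h ∈ H n, ∀ l ∈ X n, (iteratedStage S n).act h l ∈ X n}
    (hH : ∀ n, H (n + 1) = wreathSubgroup (S (n + 1)) (iteratedStage S n) (H n) (X n) (hX n))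
    {d : ℝ} (hd1 : d < 1)
    (hXd : ∀ n, ((X n).ncard : ℝ) ≤ d * Nat.card (iteratedStage S n).pt)
    (hXM : ∀ n, ∀ M : ℕ, (∀ l : (iteratedStage S n).pt,
        {m | ∃ h ∈ H n, (iteratedStage S n).act h l = m}.ncard ≤ M) →
          d * Nat.card (iteratedStage S n).pt ≤ (X n).ncard + M) :
    Tendsto (fun n => ((X n).ncard : ℝ) / Nat.card (iteratedStage S n).pt) atTop (𝓝 d) := by
  have := fun k => (hS k).nontrivial
  have hfin := fun n => (iteratedStage_finite S n).1
  have hfin' := fun n => (iteratedStage_finite S n).2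
  have hL : ∀ n, (0 : ℝ) < Nat.card (iteratedStage S n).pt := fun n => by
    exact_mod_cast (Nat.succ_pos _).trans_le (add_two_le_card_pt S n)
  set w : ℕ → ℝ := fun n => Real.log (Nat.card (IteratedWreath S n)) /
    Nat.card (iteratedStage S n).pt with hw
  -- An upper bound for the logarithm of the orbit length of Hₙ₊₁ relative to |Λₙ₊₁|, using |Xₙ| ≤
  -- d|Λₙ|, |Hₙ| ≤ |Wₙ| and |Ωₙ₊₁| ≥ 2.
  set E : ℕ → ℝ := fun n => Nat.card (iteratedStage S n).pt * (w n - (1 - d) * Real.log 2) with hE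
  have hElim : Tendsto E atTop atBot := by
    refine (tendsto_card_pt S).atTop_mul_neg (C := 0 - (1 - d) * Real.log 2) ?_
      ((tendsto_log_card_div_card_pt S).sub_const _)
    have : 0 < (1 - d) * Real.log 2 := mul_pos (by linarith) (Real.log_pos one_lt_two)
    linarith
  refine (tendsto_add_atTop_iff_nat 1).1 ?_
  have hlow : Tendsto (fun n => d - Real.exp (E n)) atTop (𝓝 d) := by
    simpa using (Real.tendsto_exp_atBot.comp hElim).const_sub d
  refine tendsto_of_tendsto_of_tendsto_of_le_of_le hlow tendsto_const_nhds (fun n => ?_)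
    (fun n => (div_le_iff₀ (hL _)).2 (hXd _))
  have hM := hXM (n + 1) (Nat.card (H n) * Nat.card (Ω (n + 1)) ^ (X n).ncard) fun f => by
    rw [hH]
    exact ncard_orbit_wreathSubgroup_le (H n) (X n) (hX n) f
  have ho : (2 : ℝ) ≤ Nat.card (Ω (n + 1)) := by
    exact_mod_cast (Finite.one_lt_card : 1 < Nat.card (Ω (n + 1)))
  have hlo : Real.log 2 ≤ Real.log (Nat.card (Ω (n + 1))) := Real.log_le_log two_pos ho
  have hHpos : (0 : ℝ) < Nat.card (H n) := by exact_mod_cast Nat.card_pos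
  have hHW : Real.log (Nat.card (H n)) ≤ Real.log (Nat.card (IteratedWreath S n)) :=
    Real.log_le_log hHpos (by exact_mod_cast Subgroup.card_le_card_group (H n))
  have hwn : Real.log (Nat.card (IteratedWreath S n)) =
      Nat.card (iteratedStage S n).pt * w n := by
    rw [hw]
    have := (hL n).ne'
    field_simp
  have hMle : ((Nat.card (H n) * Nat.card (Ω (n + 1)) ^ (X n).ncard : ℕ) : ℝ) ≤
      Real.exp (E n) * Nat.card (iteratedStage S (n + 1)).pt := by
    have h₁ : (Nat.card (iteratedStage S (n + 1)).pt : ℝ) =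
        Real.exp (Nat.card (iteratedStage S n).pt * Real.log (Nat.card (Ω (n + 1)))) := by
      rw [card_pt_succ, Nat.cast_pow, ← Real.log_pow, Real.exp_log (by positivity)]
    have h₂ : ((Nat.card (H n) * Nat.card (Ω (n + 1)) ^ (X n).ncard : ℕ) : ℝ) =
        Real.exp (Real.log (Nat.card (H n)) +
          (X n).ncard * Real.log (Nat.card (Ω (n + 1)))) := by
      rw [Real.exp_add, Real.exp_log hHpos, ← Real.log_pow, Real.exp_log (by positivity)]
      push_cast
      rfl
    rw [h₁, h₂, ← Real.exp_add, Real.exp_le_exp, hE]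
    have h₃ := mul_le_mul_of_nonneg_right (hXd n) ((Real.log_pos one_lt_two).le.trans hlo)
    have h₄ : 0 ≤ (Nat.card (iteratedStage S n).pt : ℝ) * (1 - d) *
        (Real.log (Nat.card (Ω (n + 1))) - Real.log 2) :=
      mul_nonneg (mul_nonneg (hL n).le (by linarith)) (by linarith)
    nlinarith
  rw [le_div_iff₀ (hL _)]
  linarith

theorem hasCompleteSpectrum_levelFiltration (hS : ∀ k, IsNonabelianSimpleTransitive (S k)) :
    HasCompleteSpectrum (levelFiltration S) := by
  refine Set.Subset.antisymm ?_ fun d hd => ?_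
  · rintro _ ⟨H, -, rfl⟩
    exact hausdorffDim_levelFiltration_mem_Icc S H
  -- At d = 1 the orbit estimate gives no decay, so the whole group is used instead.
  rcases hd.2.eq_or_lt with rfl | hd1
  · refine ⟨⊤, isClosed_univ, ?_⟩
    rw [hausdorffDim_levelFiltration]
    refine Tendsto.liminf_eq (tendsto_const_nhds.congr fun n => ?_)
    have hsurj : Function.Surjective (toIteratedWreath S n) := exists_wreathLimit_apply_eq S n
    rw [Subgroup.map_top_of_surjective _ hsurj, Subgroup.card_top, div_self]
    have := add_two_le_card_iteratedWreath hS n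
    exact (Real.log_pos (by exact_mod_cast (by omega : 1 < Nat.card (IteratedWreath S n)))).ne'
  obtain ⟨H, X, hX, hH, hXd, hXM⟩ := exists_sparse_subgroups S hd.1 hd.2
  let K : Subgroup (infiniteWreath S) := ⨅ n, (show Subgroup (IteratedWreath S n) from H n).comap
    (toIteratedWreath S n)
  have hmem : ∀ g : infiniteWreath S, g ∈ K ↔ ∀ n, toIteratedWreath S n g ∈
      (show Subgroup (IteratedWreath S n) from H n) := fun g => Subgroup.mem_iInf
  have hKc : IsClosed (K : Set (infiniteWreath S)) := by
    rw [Subgroup.coe_iInf]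
    refine isClosed_iInter fun n => ?_
    have hc : Continuous (toIteratedWreath S n) :=
      (continuous_apply n).comp continuous_subtype_val
    exact (isClosed_discrete
      ((show Subgroup (IteratedWreath S n) from H n) : Set (IteratedWreath S n))).preimage hc
  -- The subgroups Hₙ are compatible with projections and sections, so each is the full image of the
  -- closed subgroup `K`.
  have hmap : ∀ n, K.map (toIteratedWreath S n) = H n := fun n => by
    refine le_antisymm ?_ fun w hw => ?_
    · rintro _ ⟨g, hg, rfl⟩
      exact (hmem g).1 hg n
    · obtain ⟨g, hg, hgH, hgw⟩ := exists_mem_wreathLimit (S := S) (H := H) (m := n)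
        (fun n w hw => by
          rw [hH] at hw
          exact hw.1)
        (fun n w hw => by
          rw [hH]
          exact ⟨hw, fun _ _ => rfl⟩) hw
      exact ⟨(⟨g, hg⟩ : wreathLimit S), (hmem _).2 hgH, hgw⟩
  refine ⟨K, hKc, ?_⟩
  rw [hausdorffDim_levelFiltration]
  refine Tendsto.liminf_eq ?_
  simp only [hmap]
  exact tendsto_log_card_div_log_card S hS hH
    (tendsto_ncard_div_card_pt S hS hH hd1 hXd hXM)

end Spectrum

/-! ### Constant sequences and alternating groups. -/

theorem isGoodSequence_const {Ω : Type u} (T : Subgroup (Equiv.Perm Ω)) :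
    IsGoodSequence (fun _ : ℕ => T) :=
  ⟨1, one_pos, 0, fun _ _ => by rw [Real.rpow_one]⟩

theorem isNonabelianSimpleTransitive_alternatingGroup {α : Type*} [Fintype α] [DecidableEq α]
    (hα : 5 ≤ Nat.card α) : IsNonabelianSimpleTransitive (alternatingGroup α) where
  isPretransitive := alternatingGroup.isPretransitive_of_three_le_card α (by omega)
  isSimpleGroup := alternatingGroup.isSimpleGroup hα
  not_comm h := by
    have := (alternatingGroup.isMulCommutative_iff_card_le_three (α := α)).1 ⟨⟨h⟩⟩
    omega

/-- There are hereditarily just infinite profinite groups with complete Hausdorff dimension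
spectrum. In fact every infinitely iterated wreath product in product action of a good sequence of
finite transitive non-abelian simple permutation groups is one, with respect to the filtration by
the kernels of the projections to the finite levels; constant sequences are good, and there are
constant sequences of this kind. -/
theorem corollaryB :
    (∃ (G : ProfiniteGrp.{0}) (F : NormalFiltration G),
      IsHereditarilyJustInfinite G ∧ HasCompleteSpectrum F) ∧
    (∀ (Ω : ℕ → Type u) [∀ k, Finite (Ω k)] (S : ∀ k, Subgroup (Equiv.Perm (Ω k))),
      (∀ k, IsNonabelianSimpleTransitive (S k)) → IsGoodSequence S →
        IsHereditarilyJustInfinite (infiniteWreath S) ∧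
        HasCompleteSpectrum (levelFiltration S)) ∧
    (∀ (Ω : Type u) [Finite Ω] (T : Subgroup (Equiv.Perm Ω)),
      IsNonabelianSimpleTransitive T → IsGoodSequence (fun _ : ℕ => T)) ∧
    (∃ (Ω : Type) (_ : Finite Ω) (T : Subgroup (Equiv.Perm Ω)),
      IsNonabelianSimpleTransitive T ∧
        IsHereditarilyJustInfinite (infiniteWreath (fun _ : ℕ => T)) ∧
        HasCompleteSpectrum (levelFiltration (fun _ : ℕ => T))) := by
  have hT : IsNonabelianSimpleTransitive (alternatingGroup (Fin 5)) :=
    isNonabelianSimpleTransitive_alternatingGroup (by simp)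
  have hT' : IsHereditarilyJustInfinite (infiniteWreath fun _ : ℕ => alternatingGroup (Fin 5)) ∧
      HasCompleteSpectrum (levelFiltration fun _ : ℕ => alternatingGroup (Fin 5)) :=
    ⟨isHereditarilyJustInfinite_wreathLimit fun _ => hT,
      hasCompleteSpectrum_levelFiltration _ fun _ => hT⟩
  exact ⟨⟨_, _, hT'⟩,
    fun Ω _ S hS _ => ⟨isHereditarilyJustInfinite_wreathLimit hS,
      hasCompleteSpectrum_levelFiltration S hS⟩,
    fun Ω _ T _ => isGoodSequence_const T,
    ⟨Fin 5, inferInstance, alternatingGroup (Fin 5), hT, hT'⟩⟩
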